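/- Let $W$ be a real random variable with finite variance $\sigma^2$ and mean $\mu$ that is not almost surely constant. Then there is a sequence $X_1, X_2, \ldots$ of random variables on a common probability space, each with the same distribution as $W$, that is triplewise independent (any three members with distinct indices are mutually independent) and such that the standardized partial sums $$S_n = \frac{1}{\sigma\sqrt n}\Bigl(\sum_{k=1}^n X_k - n\mu\Bigr)$$ converge in law, as $n \to \infty$, to a probability distribution that is not normal. Moreover, the sequence can be chosen so that, for some integer $\ell \ge 2$ and some $r \in (0,1]$, the limit is the law of $\sqrt{1-r^2}\,Z + rY$, where $Z$ is standard normal, $Y$ is independent of $Z$, and $Y$ has the (symmetric) variance-gamma distribution, that is, the law of $(\ell-1)^{-1/2}\sqrt{G}\,N$ with $G$ gamma distributed with shape $(\ell-1)/2$ and rate $1/2$ and $N$ a standard normal variable independent of $G$. -/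

import Mathlib

open MeasureTheory ProbabilityTheory Filter

/-- A family of real random variables is `K`-tuplewise independent if the members at any `K`
distinct indices are mutually independent. -/
def TuplewiseIndep {ι Ω : Type*} [MeasurableSpace Ω] (K : ℕ) (X : ι → Ω → ℝ) (P : Measure Ω) :
    Prop :=
  ∀ i : Fin K → ι, Function.Injective i → iIndepFun (fun j => X (i j)) P

/-- The standardized partial sum `S_n = (σ √n)⁻¹ (X_1 + ⋯ + X_n - n m)`; the term `X_k` of the
sequence is `X (k - 1)`. -/
noncomputable def standardizedSum {Ω : Type*} (m σ : ℝ) (X : ℕ → Ω → ℝ) (n : ℕ) (ω : Ω) : ℝ :=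
  1 / (σ * √(n : ℝ)) * ((∑ k ∈ Finset.range n, X k ω) - n * m)

/-- The variance-gamma distribution with parameters `k > 0`, `θ`, `s > 0`, `c`: the law of
`c + θ G + s √G Z`, where `G` is gamma distributed with shape `k / 2` and rate `1 / 2`, and `Z` is
standard normal and independent of `G`. -/
noncomputable def varianceGamma (k θ s c : ℝ) : Measure ℝ :=
  ((gammaMeasure (k / 2) (1 / 2)).prod (gaussianReal 0 1)).map
    (fun p => c + θ * p.1 + s * √p.1 * p.2)

/-- The law of `√(1 - r²) Z + r Y`, where `Z` is standard normal and `Y` is independent of `Z`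
with law `ν`. -/
noncomputable def normalCombination (r : ℝ) (ν : Measure ℝ) : Measure ℝ :=
  ((gaussianReal 0 1).prod ν).map (fun p => √(1 - r ^ 2) * p.1 + r * p.2)

open scoped ENNReal Topology

/-! Attach independent fair signs to the vertices of the complete bipartite graph on two copies of
`ℕ`, and give each edge the product of the signs of its ends. A bipartite graph has no triangle, so
any three edges form a forest and their signs are independent, although four edges on a cycle have
signs with product 1.

Standardize `W` to a law `η`, and write `η` as the balanced mixture of two laws with means `r` and
`-r`, where `r` is the integral of `x` over `x > 0`. Sampling the `k`-th variable from the half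
named by the `k`-th edge gives margins `η` and keeps triplewise independence, because characteristic
functions of the samples are affine in the edge signs.

Given the signs, the samples are independent, so the normalized sum is asymptotically normal with
mean `r` times the normalized sum of edge signs and variance `1 - r²`. Over the edges of a complete
`m × m` graph the sum of signs factors into two independent coin sums, so its normalization tends to
a product of two independent standard normals. That product is the variance-gamma law with `ℓ = 2`.
This is `tendsto_integral_exp_sum_edgeSign` for the signs and
`tendsto_integral_prod_charFun_edgeLabel` for the samples;
`normalCombination_varianceGamma_ne_gaussianReal` excludes normality. -/

/-! ### Fair coins -/

/-- The law of a fair coin. -/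
noncomputable def fairCoin : Measure Bool :=
  (2⁻¹ : ℝ≥0∞) • Measure.dirac true + (2⁻¹ : ℝ≥0∞) • Measure.dirac false

instance isProbabilityMeasure_fairCoin : IsProbabilityMeasure fairCoin :=
  ⟨by simp [fairCoin, ENNReal.inv_two_add_inv_two]⟩

/-- The law of a sequence of independent fair coins. -/
noncomputable def coins : Measure (ℕ → Bool) := Measure.infinitePi fun _ => fairCoin

instance isProbabilityMeasure_coins : IsProbabilityMeasure coins := by
  unfold coins; infer_instance

/-- The sign `±1` attached to a Boolean. -/
def boolSign (b : Bool) : ℝ := if b then 1 else -1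

@[simp] lemma boolSign_true : boolSign true = 1 := rfl

@[simp] lemma boolSign_false : boolSign false = -1 := rfl

lemma boolSign_not (b : Bool) : boolSign (!b) = -boolSign b := by cases b <;> simp

lemma boolSign_beq (b c : Bool) : boolSign (b == c) = boolSign b * boolSign c := by
  cases b <;> cases c <;> simp

lemma boolSign_mul_self (b : Bool) : boolSign b * boolSign b = 1 := by cases b <;> simp

lemma abs_boolSign (b : Bool) : |boolSign b| = 1 := by cases b <;> simp

lemma integral_fairCoin {E : Type*} [NormedAddCommGroup E] [NormedSpace ℝ E] [CompleteSpace E]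
    (f : Bool → E) : ∫ b, f b ∂fairCoin = (2⁻¹ : ℝ) • f true + (2⁻¹ : ℝ) • f false := by
  unfold fairCoin
  rw [integral_add_measure, integral_smul_measure, integral_smul_measure, integral_dirac,
    integral_dirac]
  · simp
  · exact (integrable_dirac (by simp)).smul_measure (by simp)
  · exact (integrable_dirac (by simp)).smul_measure (by simp)

/-- Turn over the coin with index `v`. -/
def flipCoin (v : ℕ) (ω : ℕ → Bool) : ℕ → Bool := fun w => if w = v then !(ω w) else ω w

lemma measurePreserving_flipCoin (v : ℕ) : MeasurePreserving (flipCoin v) coins coins := by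
  have hm : ∀ w : ℕ, Measurable (fun b : Bool => if w = v then !b else b) := fun _ => by fun_prop
  refine ⟨?_, ?_⟩
  · exact measurable_pi_lambda _ fun w => (hm w).comp (measurable_pi_apply w)
  · unfold coins flipCoin
    rw [Measure.infinitePi_map_pi (f := fun w b => if w = v then !b else b) _ hm]
    congr 1
    ext1 w
    by_cases h : w = v
    · simp only [h, if_true, fairCoin]
      rw [Measure.map_add _ _ (by fun_prop), Measure.map_smul, Measure.map_smul,
        Measure.map_dirac' (by fun_prop), Measure.map_dirac' (by fun_prop), add_comm]
      rfl
    · simp [h]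

/-- The law of two independent sequences of independent fair coins. -/
noncomputable def coinPairs : Measure ((ℕ → Bool) × (ℕ → Bool)) := coins.prod coins

instance isProbabilityMeasure_coinPairs : IsProbabilityMeasure coinPairs := by
  unfold coinPairs; infer_instance

/-- Used with `T` the turning of one coin: a product of edge signs has mean zero as soon as some
vertex lies on an odd number of its edges. -/
lemma MeasureTheory.MeasurePreserving.integral_eq_zero_of_comp_eq_neg {α : Type*}
    [MeasurableSpace α] {μ : Measure α} {T : α → α} (hT : MeasurePreserving T μ μ) {f : α → ℝ}
    (hf : Measurable f) (h : ∀ x, f (T x) = -f x) : ∫ x, f x ∂μ = 0 := by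
  have h1 : ∫ x, f (T x) ∂μ = ∫ x, f x ∂μ := by
    conv_rhs => rw [← hT.map_eq]
    rw [integral_map hT.measurable.aemeasurable hf.aestronglyMeasurable]
  simp only [h, integral_neg] at h1
  linarith

lemma measurePreserving_flipCoin_fst (v : ℕ) :
    MeasurePreserving (Prod.map (flipCoin v) id) coinPairs coinPairs :=
  (measurePreserving_flipCoin v).prod (.id _)

lemma measurePreserving_flipCoin_snd (v : ℕ) :
    MeasurePreserving (Prod.map id (flipCoin v)) coinPairs coinPairs :=
  (MeasurePreserving.id _).prod (measurePreserving_flipCoin v)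

/-! ### Edge labels of the complete bipartite graph -/

/-- The label of the `k`-th edge of the complete bipartite graph on two copies of `ℕ`. -/
def edgeLabel (k : ℕ) (ω : (ℕ → Bool) × (ℕ → Bool)) : Bool :=
  ω.1 k.unpair.1 == ω.2 k.unpair.2

/-- The sign of the `k`-th edge, the product of the signs of its two ends. -/
def edgeSign (k : ℕ) (ω : (ℕ → Bool) × (ℕ → Bool)) : ℝ := boolSign (edgeLabel k ω)

lemma measurable_edgeLabel (k : ℕ) : Measurable (edgeLabel k) := by
  have : edgeLabel k = (fun p : Bool × Bool => p.1 == p.2) ∘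
      fun ω : (ℕ → Bool) × (ℕ → Bool) => (ω.1 k.unpair.1, ω.2 k.unpair.2) := rfl
  rw [this]
  exact (measurable_of_finite _).comp (by fun_prop)

lemma measurable_edgeSign (k : ℕ) : Measurable (edgeSign k) :=
  (measurable_of_finite boolSign).comp (measurable_edgeLabel k)

lemma edgeSign_eq (k : ℕ) (ω : (ℕ → Bool) × (ℕ → Bool)) :
    edgeSign k ω = boolSign (ω.1 k.unpair.1) * boolSign (ω.2 k.unpair.2) :=
  boolSign_beq _ _

lemma edgeSign_flipCoin_fst (k v : ℕ) (ω : (ℕ → Bool) × (ℕ → Bool)) :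
    edgeSign k (Prod.map (flipCoin v) id ω)
      = if k.unpair.1 = v then -edgeSign k ω else edgeSign k ω := by
  simp only [edgeSign_eq, Prod.map, flipCoin, id]
  split_ifs <;> simp [boolSign_not]

lemma edgeSign_flipCoin_snd (k v : ℕ) (ω : (ℕ → Bool) × (ℕ → Bool)) :
    edgeSign k (Prod.map id (flipCoin v) ω)
      = if k.unpair.2 = v then -edgeSign k ω else edgeSign k ω := by
  simp only [edgeSign_eq, Prod.map, flipCoin, id]
  split_ifs <;> simp [boolSign_not]

lemma abs_edgeSign (k : ℕ) (ω : (ℕ → Bool) × (ℕ → Bool)) : |edgeSign k ω| = 1 :=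
  abs_boolSign _

lemma edgeSign_mul_self (k : ℕ) (ω : (ℕ → Bool) × (ℕ → Bool)) :
    edgeSign k ω * edgeSign k ω = 1 := boolSign_mul_self _

lemma integrable_edgeSign (k : ℕ) : Integrable (edgeSign k) coinPairs :=
  Integrable.of_bound (measurable_edgeSign k).aestronglyMeasurable 1
    (.of_forall fun ω => by simp [abs_edgeSign])

lemma integral_edgeSign (k : ℕ) : ∫ ω, edgeSign k ω ∂coinPairs = 0 :=
  (measurePreserving_flipCoin_fst k.unpair.1).integral_eq_zero_of_comp_eq_neg
    (measurable_edgeSign k) fun ω => by simp [edgeSign_flipCoin_fst]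

lemma unpair_ne_of_ne {k l : ℕ} (h : k ≠ l) :
    k.unpair.1 ≠ l.unpair.1 ∨ k.unpair.2 ≠ l.unpair.2 := by
  by_contra! H
  exact h (by rw [← Nat.pair_unpair k, H.1, H.2, Nat.pair_unpair])

lemma integral_edgeSign_mul {k l : ℕ} (h : k ≠ l) :
    ∫ ω, edgeSign k ω * edgeSign l ω ∂coinPairs = 0 := by
  have hm := (measurable_edgeSign k).mul (measurable_edgeSign l)
  rcases unpair_ne_of_ne h with h | h
  · refine (measurePreserving_flipCoin_fst k.unpair.1).integral_eq_zero_of_comp_eq_neg hm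
      fun ω => ?_
    simp [edgeSign_flipCoin_fst, h.symm]
  · refine (measurePreserving_flipCoin_snd k.unpair.2).integral_eq_zero_of_comp_eq_neg hm
      fun ω => ?_
    simp [edgeSign_flipCoin_snd, h.symm]

/-- Three distinct edges of a bipartite graph form a forest, so one of them has an end that belongs
to none of the others. -/
lemma integral_edgeSign_mul_mul {k l p : ℕ} (hkl : k ≠ l) (hkp : k ≠ p) (hlp : l ≠ p) :
    ∫ ω, edgeSign k ω * edgeSign l ω * edgeSign p ω ∂coinPairs = 0 := by
  have hm := ((measurable_edgeSign k).mul (measurable_edgeSign l)).mul (measurable_edgeSign p)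
  have left (v : ℕ) (hv : ∀ ω, edgeSign k (Prod.map (flipCoin v) id ω) *
      edgeSign l (Prod.map (flipCoin v) id ω) * edgeSign p (Prod.map (flipCoin v) id ω)
      = -(edgeSign k ω * edgeSign l ω * edgeSign p ω)) :=
    (measurePreserving_flipCoin_fst v).integral_eq_zero_of_comp_eq_neg hm hv
  have right (v : ℕ) (hv : ∀ ω, edgeSign k (Prod.map id (flipCoin v) ω) *
      edgeSign l (Prod.map id (flipCoin v) ω) * edgeSign p (Prod.map id (flipCoin v) ω)
      = -(edgeSign k ω * edgeSign l ω * edgeSign p ω)) :=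
    (measurePreserving_flipCoin_snd v).integral_eq_zero_of_comp_eq_neg hm hv
  have h1 := unpair_ne_of_ne hkl
  have h2 := unpair_ne_of_ne hkp
  have h3 := unpair_ne_of_ne hlp
  simp only [edgeSign_flipCoin_fst] at left
  simp only [edgeSign_flipCoin_snd] at right
  -- If the three left ends coincide, the right ends are distinct and any of them can be flipped.
  -- Otherwise some left end belongs to exactly one edge.
  by_cases a : k.unpair.1 = l.unpair.1
  · by_cases b : k.unpair.1 = p.unpair.1
    · refine right k.unpair.2 fun ω => ?_
      have c : l.unpair.2 ≠ k.unpair.2 := (h1.resolve_left (by simpa using a)).symm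
      have d : p.unpair.2 ≠ k.unpair.2 := (h2.resolve_left (by simpa using b)).symm
      simp [c, d]
    · refine left p.unpair.1 fun ω => ?_
      simp [b, a ▸ b]
  · by_cases b : k.unpair.1 = p.unpair.1
    · refine left l.unpair.1 fun ω => ?_
      simp [a, b ▸ a]
    · refine left k.unpair.1 fun ω => ?_
      simp [Ne.symm a, Ne.symm b]

/-! ### A triplewise independent sequence with given margins -/

/-- Being affine in the edge sign, products of these characteristic functions integrate to
combinations of mixed moments of edge signs. -/
lemma charFun_label_eq (ν : Bool → Measure ℝ) (k : ℕ) (ω : (ℕ → Bool) × (ℕ → Bool)) (t : ℝ) :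
    charFun (ν (edgeLabel k ω)) t = (charFun (ν true) t + charFun (ν false) t) / 2
      + edgeSign k ω * ((charFun (ν true) t - charFun (ν false) t) / 2) := by
  unfold edgeSign
  cases edgeLabel k ω <;> simp <;> ring

section LabelledSequence

variable (ν : Bool → Measure ℝ) [∀ b, IsProbabilityMeasure (ν b)]

/-- The law of a sequence of independent families `y k b` with `y k b` of law `ν b`. -/
noncomputable def labelledSamples : Measure (ℕ → Bool → ℝ) :=
  Measure.infinitePi fun _ => Measure.pi ν

instance isProbabilityMeasure_labelledSamples : IsProbabilityMeasure (labelledSamples ν) := by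
  unfold labelledSamples; infer_instance

/-- The joint law of the edge labels and of the samples. -/
noncomputable def edgeSampleLaw : Measure (((ℕ → Bool) × (ℕ → Bool)) × (ℕ → Bool → ℝ)) :=
  coinPairs.prod (labelledSamples ν)

instance isProbabilityMeasure_edgeSampleLaw : IsProbabilityMeasure (edgeSampleLaw ν) := by
  unfold edgeSampleLaw; infer_instance

/-- The `k`-th sample selected by the label of the `k`-th edge. -/
def edgeSample (k : ℕ) (x : ((ℕ → Bool) × (ℕ → Bool)) × (ℕ → Bool → ℝ)) : ℝ :=
  x.2 k (edgeLabel k x.1)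

lemma measurable_edgeSample (k : ℕ) : Measurable (edgeSample k) := by
  have h1 : Measurable fun p : Bool × (Bool → ℝ) => p.2 p.1 :=
    measurable_from_prod_countable_right fun b => measurable_pi_apply b
  exact h1.comp (((measurable_edgeLabel k).comp measurable_fst).prodMk
    ((measurable_pi_apply k).comp measurable_snd))

/-- Here the labels are frozen as `b`; the selected samples are then independent, and distinct
indices use distinct coordinates. -/
lemma integral_exp_labelledSamples {ι : Type*} [Fintype ι] {e : ι → ℕ}
    (he : Function.Injective e) (b : ℕ → Bool) (t : ι → ℝ) :
    ∫ y, Complex.exp ((∑ j, t j * y (e j) (b (e j)) : ℝ) * Complex.I) ∂(labelledSamples ν)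
      = ∏ j, charFun (ν (b (e j))) (t j) := by
  have hind : iIndepFun (fun (k : ℕ) (y : ℕ → Bool → ℝ) => y k (b k)) (labelledSamples ν) :=
    iIndepFun_infinitePi (X := fun k (z : Bool → ℝ) => z (b k)) (P := fun _ => Measure.pi ν)
      fun k => measurable_pi_apply _
  have hmeas (k : ℕ) : Measurable fun y : ℕ → Bool → ℝ => y k (b k) := by fun_prop
  have hlaw (k : ℕ) : (labelledSamples ν).map (fun y => y k (b k)) = ν (b k) := by
    have h1 : MeasurePreserving (fun y : ℕ → Bool → ℝ => y k) (labelledSamples ν)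
      (Measure.pi ν) := measurePreserving_eval_infinitePi _ k
    exact ((measurePreserving_eval ν (b k)).comp h1).map_eq
  have h := (hind.precomp he).integral_fun_prod_comp
    (f := fun j x => Complex.exp ((t j * x : ℝ) * Complex.I)) (fun j => (hmeas _).aemeasurable)
    (fun j => by fun_prop)
  simp only [Complex.ofReal_sum, Finset.sum_mul, Complex.exp_sum]
  rw [h]
  refine Finset.prod_congr rfl fun j _ => ?_
  rw [← hlaw, charFun_apply_real, integral_map (hmeas _).aemeasurable (by fun_prop)]
  simp

/-- The joint characteristic function of the selected samples. -/
lemma integral_exp_edgeSample {ι : Type*} [Fintype ι] {e : ι → ℕ}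
    (he : Function.Injective e) (t : ι → ℝ) :
    ∫ x, Complex.exp ((∑ j, t j * edgeSample (e j) x : ℝ) * Complex.I) ∂(edgeSampleLaw ν)
      = ∫ ω, ∏ j, charFun (ν (edgeLabel (e j) ω)) (t j) ∂coinPairs := by
  unfold edgeSampleLaw
  rw [integral_prod]
  · exact integral_congr_ae (.of_forall fun ω =>
      integral_exp_labelledSamples ν he (fun k => edgeLabel k ω) t)
  · have := measurable_edgeSample
    refine Integrable.of_bound (by fun_prop) 1 (.of_forall fun x => ?_)
    rw [Complex.norm_exp_ofReal_mul_I]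

/-- The edge labels are triplewise independent. -/
lemma integral_prod_affine_edgeSign {e : Fin 3 → ℕ} (he : Function.Injective e) (α β : Fin 3 → ℂ) :
    ∫ ω, ∏ j, (α j + edgeSign (e j) ω * β j) ∂coinPairs = ∏ j, α j := by
  have h01 : e 0 ≠ e 1 := he.ne (by decide)
  have h02 : e 0 ≠ e 2 := he.ne (by decide)
  have h12 : e 1 ≠ e 2 := he.ne (by decide)
  have hm := measurable_edgeSign
  have hc (f : (ℕ → Bool) × (ℕ → Bool) → ℝ) (c : ℂ) (h0 : ∫ ω, f ω ∂coinPairs = 0) :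
      ∫ ω, (f ω : ℂ) * c ∂coinPairs = 0 := by
    rw [integral_mul_const, integral_complex_ofReal, h0]; simp
  have hi (f : (ℕ → Bool) × (ℕ → Bool) → ℝ) (c : ℂ) (hf : Measurable f)
      (h1 : ∀ ω, |f ω| = 1) : Integrable (fun ω => (f ω : ℂ) * c) coinPairs :=
    (Integrable.of_bound (by fun_prop) 1 (.of_forall fun ω => by simp [h1])).mul_const c
  -- Of the eight terms of the expansion only the constant one survives integration.
  have key : (fun ω => ∏ j, (α j + edgeSign (e j) ω * β j)) = fun ω =>
      α 0 * α 1 * α 2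
      + (((edgeSign (e 0) ω : ℝ) : ℂ) * (β 0 * α 1 * α 2)
      + (((edgeSign (e 1) ω : ℝ) : ℂ) * (α 0 * β 1 * α 2)
      + (((edgeSign (e 2) ω : ℝ) : ℂ) * (α 0 * α 1 * β 2)
      + (((edgeSign (e 0) ω * edgeSign (e 1) ω : ℝ) : ℂ) * (β 0 * β 1 * α 2)
      + (((edgeSign (e 0) ω * edgeSign (e 2) ω : ℝ) : ℂ) * (β 0 * α 1 * β 2)
      + (((edgeSign (e 1) ω * edgeSign (e 2) ω : ℝ) : ℂ) * (α 0 * β 1 * β 2)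
      + ((edgeSign (e 0) ω * edgeSign (e 1) ω * edgeSign (e 2) ω : ℝ) : ℂ)
          * (β 0 * β 1 * β 2))))))) := by
    ext ω
    rw [Fin.prod_univ_three]
    push_cast
    ring
  have i1 (j) (c : ℂ) := hi (fun ω => edgeSign (e j) ω) c (hm _) (abs_edgeSign _)
  have i2 (j l) (c : ℂ) := hi (fun ω => edgeSign (e j) ω * edgeSign (e l) ω) c
    (by fun_prop) (fun ω => by simp [abs_mul, abs_edgeSign])
  have i3 (c : ℂ) := hi (fun ω => edgeSign (e 0) ω * edgeSign (e 1) ω * edgeSign (e 2) ω) c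
    (by fun_prop) (fun ω => by simp [abs_mul, abs_edgeSign])
  have j6 := fun a b => (i2 1 2 a).fun_add (i3 b)
  have j5 := fun a b c => (i2 0 2 a).fun_add (j6 b c)
  have j4 := fun a b c d => (i2 0 1 a).fun_add (j5 b c d)
  have j3 := fun a b c d x => (i1 2 a).fun_add (j4 b c d x)
  have j2 := fun a b c d x y => (i1 1 a).fun_add (j3 b c d x y)
  have j1 := fun a b c d x y z => (i1 0 a).fun_add (j2 b c d x y z)
  rw [key, integral_add (integrable_const _) (j1 ..), integral_add (i1 ..) (j2 ..),
    integral_add (i1 ..) (j3 ..), integral_add (i1 ..) (j4 ..), integral_add (i2 ..) (j5 ..),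
    integral_add (i2 ..) (j6 ..), integral_add (i2 ..) (i3 ..),
    hc _ _ (integral_edgeSign _), hc _ _ (integral_edgeSign _), hc _ _ (integral_edgeSign _),
    hc _ _ (integral_edgeSign_mul h01), hc _ _ (integral_edgeSign_mul h02),
    hc _ _ (integral_edgeSign_mul h12), hc _ _ (integral_edgeSign_mul_mul h01 h02 h12)]
  simp [Fin.prod_univ_three]

lemma charFun_map_edgeSample (k : ℕ) (t : ℝ) :
    charFun ((edgeSampleLaw ν).map (edgeSample k)) t
      = (charFun (ν true) t + charFun (ν false) t) / 2 := by
  have h := integral_exp_edgeSample ν (ι := Unit) (e := fun _ => k)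
    (fun _ _ _ => rfl) (fun _ => t)
  rw [charFun_apply_real, integral_map (measurable_edgeSample k).aemeasurable (by fun_prop)]
  simp only [Finset.univ_unique, Finset.sum_singleton, Finset.prod_singleton] at h
  push_cast at h
  rw [h]
  simp only [charFun_label_eq]
  rw [integral_add (integrable_const _)
    ((integrable_edgeSign k).ofReal.mul_const _), integral_mul_const, integral_complex_ofReal,
    integral_edgeSign]
  simp

/-- The selected samples are triplewise independent. -/
lemma tuplewiseIndep_edgeSample : TuplewiseIndep 3 edgeSample (edgeSampleLaw ν) := by
  intro e he
  rw [iIndepFun_iff_charFun_pi fun j => (measurable_edgeSample _).aemeasurable]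
  intro t
  have hm := measurable_edgeSample
  rw [charFun_apply, integral_map (by fun_prop) (by fun_prop)]
  have h := integral_exp_edgeSample ν he t
  simp only [charFun_label_eq] at h
  rw [integral_prod_affine_edgeSign he] at h
  simp only [charFun_map_edgeSample]
  rw [← h]
  simp [PiLp.inner_apply]

/-- The selected samples are distributed as the balanced mixture of the two sample laws. -/
lemma map_edgeSample {η : Measure ℝ} [IsProbabilityMeasure η]
    (hη : ∀ t, charFun η t = (charFun (ν true) t + charFun (ν false) t) / 2) (k : ℕ) :
    (edgeSampleLaw ν).map (edgeSample k) = η := by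
  have := Measure.isProbabilityMeasure_map (μ := edgeSampleLaw ν)
    (measurable_edgeSample k).aemeasurable
  refine Measure.ext_of_charFun ?_
  ext t
  rw [charFun_map_edgeSample, hη]

/-- The characteristic function of a partial sum of the selected samples. -/
lemma charFun_map_mul_sum_edgeSample (n : ℕ) (c t : ℝ) :
    charFun ((edgeSampleLaw ν).map fun x => c * ∑ k ∈ Finset.range n, edgeSample k x) t
      = ∫ ω, ∏ k ∈ Finset.range n, charFun (ν (edgeLabel k ω)) (c * t) ∂coinPairs := by
  have hm := measurable_edgeSample
  rw [charFun_apply_real, integral_map (by fun_prop) (by fun_prop)]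
  have h := integral_exp_edgeSample ν (Fin.val_injective (n := n)) (fun _ => c * t)
  simp only [Finset.prod_range]
  rw [← h]
  refine integral_congr_ae (.of_forall fun x => ?_)
  simp only [Finset.sum_range]
  congr 2
  push_cast
  rw [← Finset.mul_sum]
  ring

end LabelledSequence

/-! ### Partial sums of the edge signs -/

lemma norm_exp_ofReal_mul_I_sub_le (x y : ℝ) :
    ‖Complex.exp (x * Complex.I) - Complex.exp (y * Complex.I)‖ ≤ |x - y| := by
  have h : Complex.exp (x * Complex.I) - Complex.exp (y * Complex.I)
      = Complex.exp (y * Complex.I) * (Complex.exp (Complex.I * (x - y : ℝ)) - 1) := by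
    rw [mul_sub, ← Complex.exp_add]
    push_cast
    ring_nf
  rw [h, norm_mul, Complex.norm_exp_ofReal_mul_I, one_mul]
  simpa using Real.norm_exp_I_mul_ofReal_sub_one_le (x := x - y)

lemma measurable_sum_edgeSign (s : Finset ℕ) :
    Measurable fun ω => ∑ k ∈ s, edgeSign k ω :=
  Finset.measurable_fun_sum _ fun k _ => measurable_edgeSign k

lemma abs_sum_edgeSign_le (s : Finset ℕ) (ω : (ℕ → Bool) × (ℕ → Bool)) :
    |∑ k ∈ s, edgeSign k ω| ≤ s.card := by
  refine (Finset.abs_sum_le_sum_abs _ _).trans (le_of_eq ?_)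
  simp [abs_edgeSign]

lemma integrable_sum_edgeSign (s : Finset ℕ) :
    Integrable (fun ω => ∑ k ∈ s, edgeSign k ω) coinPairs :=
  integrable_finsetSum _ fun k _ => integrable_edgeSign k

lemma integral_sum_edgeSign_sq (s : Finset ℕ) :
    ∫ ω, (∑ k ∈ s, edgeSign k ω) ^ 2 ∂coinPairs = s.card := by
  have hi (k l : ℕ) : Integrable (fun ω => edgeSign k ω * edgeSign l ω) coinPairs :=
    Integrable.of_bound ((measurable_edgeSign k).mul (measurable_edgeSign l)).aestronglyMeasurable
      1 (.of_forall fun ω => by simp [abs_edgeSign])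
  simp only [sq, Finset.sum_mul_sum]
  rw [integral_finsetSum _ fun k _ => integrable_finsetSum _ fun l _ => hi k l]
  have h (k : ℕ) (hk : k ∈ s) :
      ∫ ω, ∑ l ∈ s, edgeSign k ω * edgeSign l ω ∂coinPairs = 1 := by
    rw [integral_finsetSum _ fun l _ => hi k l, Finset.sum_eq_single k]
    · simp [edgeSign_mul_self]
    · intro l _ hl
      exact integral_edgeSign_mul hl.symm
    · exact fun h => absurd hk h
  rw [Finset.sum_congr rfl h]
  simp

/-- The edge signs are orthonormal, so their sums are at most of the order of the square root of
the number of terms. -/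
lemma integral_abs_sum_edgeSign_le (s : Finset ℕ) :
    ∫ ω, |∑ k ∈ s, edgeSign k ω| ∂coinPairs ≤ √(s.card : ℝ) := by
  rcases s.eq_empty_or_nonempty with rfl | hs
  · simp
  have hc : 0 < √(s.card : ℝ) := Real.sqrt_pos.2 (by exact_mod_cast hs.card_pos)
  have hsq : √(s.card : ℝ) ^ 2 = s.card := Real.sq_sqrt (by positivity)
  have hi2 : Integrable (fun ω => (∑ k ∈ s, edgeSign k ω) ^ 2) coinPairs := by
    refine Integrable.of_bound ((measurable_sum_edgeSign s).pow_const 2).aestronglyMeasurable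
      ((s.card : ℝ) ^ 2) (.of_forall fun ω => ?_)
    rw [norm_pow, Real.norm_eq_abs]
    exact pow_le_pow_left₀ (abs_nonneg _) (abs_sum_edgeSign_le s ω) 2
  -- The inequality `2 c |S| ≤ S² + c²` with `c = √(s.card)` stands in for Cauchy–Schwarz.
  have h : ∫ ω, 2 * √(s.card : ℝ) * |∑ k ∈ s, edgeSign k ω| ∂coinPairs
      ≤ ∫ ω, ((∑ k ∈ s, edgeSign k ω) ^ 2 + s.card) ∂coinPairs := by
    refine integral_mono ((integrable_sum_edgeSign s).abs.const_mul _)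
      (hi2.fun_add (integrable_const _)) fun ω => ?_
    have := sq_nonneg (|∑ k ∈ s, edgeSign k ω| - √(s.card : ℝ))
    have := sq_abs (∑ k ∈ s, edgeSign k ω)
    simp only
    nlinarith
  rw [integral_const_mul, integral_add hi2 (integrable_const _), integral_sum_edgeSign_sq,
    integral_const] at h
  simp only [probReal_univ, one_smul] at h
  nlinarith

/-- `Nat.pair` fills successive square shells, so the first `m * m` edges are exactly those of the
complete `m × m` graph; this lets the sum of their signs factor. -/
lemma lt_mul_self_iff_unpair (k m : ℕ) : k < m * m ↔ k.unpair.1 < m ∧ k.unpair.2 < m := by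
  have h1 := Nat.pair_lt_max_add_one_sq k.unpair.1 k.unpair.2
  have h2 := Nat.max_sq_add_min_le_pair k.unpair.1 k.unpair.2
  rw [Nat.pair_unpair] at h1 h2
  rw [← max_lt_iff]
  constructor
  · intro h
    by_contra! H
    have := Nat.mul_self_le_mul_self H
    rw [← sq (max _ _)] at this
    omega
  · intro h
    have := Nat.mul_self_le_mul_self (Nat.succ_le_of_lt h)
    simp only [Nat.succ_eq_add_one] at this
    nlinarith

lemma sum_edgeSign_mul_self (m : ℕ) (ω : (ℕ → Bool) × (ℕ → Bool)) :
    ∑ k ∈ Finset.range (m * m), edgeSign k ω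
      = (∑ i ∈ Finset.range m, boolSign (ω.1 i)) * ∑ j ∈ Finset.range m, boolSign (ω.2 j) := by
  rw [Finset.sum_mul_sum, ← Finset.sum_product']
  refine Finset.sum_nbij' Nat.unpair (fun p => Nat.pair p.1 p.2) ?_ ?_ ?_ ?_ ?_
  · intro k hk
    simpa using (lt_mul_self_iff_unpair k m).1 (by simpa using hk)
  · intro p hp
    simpa [lt_mul_self_iff_unpair] using hp
  · intro k _; simp
  · intro p _; simp
  · intro k _; exact edgeSign_eq k ω

/-- The normalized sum of the first `m` coins. -/
noncomputable def normalizedCoinSum (m : ℕ) (ω : ℕ → Bool) : ℝ :=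
  (√(m : ℝ))⁻¹ * ∑ i ∈ Finset.range m, boolSign (ω i)

lemma measurable_normalizedCoinSum (m : ℕ) : Measurable (normalizedCoinSum m) := by
  have := measurable_of_finite boolSign
  unfold normalizedCoinSum
  fun_prop

lemma map_eval_coins (i : ℕ) : coins.map (fun ω => ω i) = fairCoin :=
  Measure.infinitePi_map_eval _ i

lemma tendstoInDistribution_normalizedCoinSum :
    TendstoInDistribution normalizedCoinSum atTop id (fun _ => coins) (gaussianReal 0 1) := by
  have hm : Measurable boolSign := measurable_of_finite boolSign
  have hint (f : Bool → ℝ) (i : ℕ) : ∫ ω, f (ω i) ∂coins = 2⁻¹ * f true + 2⁻¹ * f false := by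
    have := integral_fairCoin f
    rw [← map_eval_coins i, integral_map (measurable_pi_apply i).aemeasurable (by fun_prop)] at this
    simpa using this
  refine tendstoInDistribution_inv_sqrt_mul_sum (X := fun i (ω : ℕ → Bool) => boolSign (ω i)) ⟨by fun_prop,
    Measure.map_id⟩ ?_ ?_ ?_ ?_
  · rw [hint]; simp
  · have := hint (fun b => boolSign b ^ 2) 0
    simp only [Pi.pow_apply]
    rw [this]; simp; norm_num
  · exact iIndepFun_infinitePi (X := fun _ => boolSign) (P := fun _ => fairCoin) fun _ => hm
  · intro i
    have h (i : ℕ) : IdentDistrib (fun ω : ℕ → Bool => ω i) (fun b : Bool => b) coins fairCoin :=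
      ⟨(measurable_pi_apply i).aemeasurable, by fun_prop, by rw [map_eval_coins, Measure.map_id']⟩
    exact ((h i).trans (h 0).symm).comp hm

/-- The law of the product of two independent standard normal variables. -/
noncomputable def gaussianProductLaw : Measure ℝ :=
  ((gaussianReal 0 1).prod (gaussianReal 0 1)).map fun p => p.1 * p.2

/-- Along squares the normalized sum is a product of two independent normalized coin sums, so the
central limit theorem and continuity of multiplication apply. -/
lemma tendsto_integral_exp_sum_edgeSign_mul_self (θ : ℝ) :
    Tendsto (fun m : ℕ => ∫ ω, Complex.exp ((θ * ((m : ℝ)⁻¹ *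
        ∑ k ∈ Finset.range (m * m), edgeSign k ω) : ℝ) * Complex.I) ∂coinPairs)
      atTop (𝓝 (charFun gaussianProductLaw θ)) := by
  have h := tendstoInDistribution_normalizedCoinSum.tendsto
  have h2 := ((ProbabilityMeasure.continuous_prod (α := ℝ) (β := ℝ)).tendsto _).comp
    (h.prodMk_nhds h)
  have h3 := ProbabilityMeasure.tendsto_map_of_tendsto_of_continuous _ _ h2
    (continuous_mul (M := ℝ))
  have h4 := ProbabilityMeasure.tendsto_iff_tendsto_charFun.1 h3 θ
  have hmm := measurable_normalizedCoinSum
  convert h4 using 1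
  · ext m
    change _ = charFun (((coins.map (normalizedCoinSum m)).prod
      (coins.map (normalizedCoinSum m))).map fun p : ℝ × ℝ => p.1 * p.2) θ
    rw [Measure.map_prod_map _ _ (hmm m) (hmm m), Measure.map_map (by fun_prop) (by fun_prop),
      charFun_apply_real, integral_map (by fun_prop) (by fun_prop)]
    refine integral_congr_ae (.of_forall fun ω => ?_)
    simp only [Function.comp_apply, Prod.map, normalizedCoinSum, sum_edgeSign_mul_self]
    have : ((√(m : ℝ))⁻¹ * (√(m : ℝ))⁻¹) = (m : ℝ)⁻¹ := by
      rw [← mul_inv, Real.mul_self_sqrt (by positivity)]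
    rw [← this]
    push_cast
    ring_nf
  · change _ = 𝓝 (charFun ((((gaussianReal 0 1).map id).prod
      ((gaussianReal 0 1).map id)).map fun p : ℝ × ℝ => p.1 * p.2) θ)
    simp only [gaussianProductLaw, Measure.map_id]

/-- Passes from squares to all `n`. The first term of the bound pays for the edges beyond the last
full square, the second for replacing `n.sqrt` by `√n` in the normalization. -/
lemma integral_abs_sum_edgeSign_sub_le {n : ℕ} (hn : 0 < n) :
    ∫ ω, |(√(n : ℝ))⁻¹ * ∑ k ∈ Finset.range n, edgeSign k ω
        - (n.sqrt : ℝ)⁻¹ * ∑ k ∈ Finset.range (n.sqrt * n.sqrt), edgeSign k ω| ∂coinPairs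
      ≤ √(2 * (√(n : ℝ))⁻¹) + (√(n : ℝ))⁻¹ := by
  set m := n.sqrt with hm
  have hmn : m * m ≤ n := Nat.sqrt_le n
  have hm0 : (0 : ℝ) < m := by exact_mod_cast Nat.sqrt_pos.2 hn
  have hn0 : (0 : ℝ) < √(n : ℝ) := Real.sqrt_pos.2 (by exact_mod_cast hn)
  have hsq : √(n : ℝ) * √(n : ℝ) = n := Real.mul_self_sqrt (by positivity)
  have hle : (m : ℝ) ≤ √(n : ℝ) := Real.nat_sqrt_le_real_sqrt
  have hlt : √(n : ℝ) ≤ m + 1 := Real.real_sqrt_le_nat_sqrt_succ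
  set s := Finset.Ico (m * m) n
  have hsplit (ω) : (√(n : ℝ))⁻¹ * ∑ k ∈ Finset.range n, edgeSign k ω
      - (m : ℝ)⁻¹ * ∑ k ∈ Finset.range (m * m), edgeSign k ω
      = (√(n : ℝ))⁻¹ * ∑ k ∈ s, edgeSign k ω
        - ((m : ℝ)⁻¹ - (√(n : ℝ))⁻¹) * ∑ k ∈ Finset.range (m * m), edgeSign k ω := by
    rw [← Finset.sum_range_add_sum_Ico _ hmn]
    ring
  have hinv : 0 ≤ (m : ℝ)⁻¹ - (√(n : ℝ))⁻¹ := sub_nonneg.2 (inv_anti₀ hm0 hle)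
  -- `n - m² = (√n - m)(√n + m)`, where the first factor is at most 1 and the second at most `2 √n`.
  have hcard : (s.card : ℝ) ≤ 2 * √(n : ℝ) := by
    simp only [s, Nat.card_Ico]
    rw [Nat.cast_sub hmn]
    push_cast
    nlinarith
  have hA : (√(n : ℝ))⁻¹ * √(s.card : ℝ) ≤ √(2 * (√(n : ℝ))⁻¹) := by
    refine Real.le_sqrt_of_sq_le ?_
    rw [mul_pow, Real.sq_sqrt (by positivity)]
    calc (√(n : ℝ))⁻¹ ^ 2 * s.card ≤ (√(n : ℝ))⁻¹ ^ 2 * (2 * √(n : ℝ)) := by gcongr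
      _ = 2 * (√(n : ℝ))⁻¹ := by field_simp
  have hB : ((m : ℝ)⁻¹ - (√(n : ℝ))⁻¹) * √((Finset.range (m * m)).card : ℝ) ≤ (√(n : ℝ))⁻¹ := by
    rw [Finset.card_range, Nat.cast_mul, Real.sqrt_mul_self hm0.le]
    rw [sub_mul, inv_mul_cancel₀ hm0.ne', inv_mul_eq_div, inv_eq_one_div, sub_le_iff_le_add,
      ← add_div, le_div_iff₀ hn0]
    linarith
  calc _ ≤ ∫ ω, ((√(n : ℝ))⁻¹ * |∑ k ∈ s, edgeSign k ω|
        + ((m : ℝ)⁻¹ - (√(n : ℝ))⁻¹) * |∑ k ∈ Finset.range (m * m), edgeSign k ω|) ∂coinPairs := by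
        refine integral_mono ?_ ?_ fun ω => ?_
        · exact (((integrable_sum_edgeSign _).const_mul _).sub
            ((integrable_sum_edgeSign _).const_mul _)).abs
        · exact ((integrable_sum_edgeSign _).abs.const_mul _).fun_add
            ((integrable_sum_edgeSign _).abs.const_mul _)
        · simp only
          rw [hsplit]
          refine (abs_sub _ _).trans (le_of_eq ?_)
          rw [abs_mul, abs_mul, abs_of_nonneg hinv, abs_of_pos (inv_pos.2 hn0)]
    _ ≤ (√(n : ℝ))⁻¹ * √(s.card : ℝ)
        + ((m : ℝ)⁻¹ - (√(n : ℝ))⁻¹) * √((Finset.range (m * m)).card : ℝ) := by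
        rw [integral_add ((integrable_sum_edgeSign _).abs.const_mul _)
          ((integrable_sum_edgeSign _).abs.const_mul _), integral_const_mul, integral_const_mul]
        gcongr
        · exact integral_abs_sum_edgeSign_le _
        · exact integral_abs_sum_edgeSign_le _
    _ ≤ _ := add_le_add hA hB

lemma tendsto_inv_sqrt_natCast : Tendsto (fun n : ℕ => (√(n : ℝ))⁻¹) atTop (𝓝 0) :=
  tendsto_inv_atTop_zero.comp (Real.tendsto_sqrt_atTop.comp tendsto_natCast_atTop_atTop)

lemma norm_integral_exp_sub_integral_exp_le {α : Type*} [MeasurableSpace α] {μ : Measure α}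
    [IsProbabilityMeasure μ] {f g : α → ℝ} (hf : Integrable f μ) (hg : Integrable g μ) (θ : ℝ) :
    ‖∫ x, Complex.exp ((θ * f x : ℝ) * Complex.I) ∂μ
        - ∫ x, Complex.exp ((θ * g x : ℝ) * Complex.I) ∂μ‖ ≤ |θ| * ∫ x, |f x - g x| ∂μ := by
  have hi {f : α → ℝ} (hf : Integrable f μ) :
      Integrable (fun x => Complex.exp ((θ * f x : ℝ) * Complex.I)) μ := by
    have := hf.1.aemeasurable
    refine Integrable.of_bound (AEMeasurable.aestronglyMeasurable (by fun_prop)) 1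
      (.of_forall fun x => ?_)
    rw [Complex.norm_exp_ofReal_mul_I]
  rw [← integral_sub (hi hf) (hi hg), ← integral_const_mul]
  refine norm_integral_le_of_norm_le ((hf.sub hg).abs.const_mul _) (.of_forall fun x => ?_)
  refine (norm_exp_ofReal_mul_I_sub_le _ _).trans (le_of_eq ?_)
  rw [← mul_sub, abs_mul]

/-- The normalized sums of the edge signs converge in law to the product of two independent
standard normal variables. -/
lemma tendsto_integral_exp_sum_edgeSign (θ : ℝ) :
    Tendsto (fun n : ℕ => ∫ ω, Complex.exp ((θ * ((√(n : ℝ))⁻¹ *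
        ∑ k ∈ Finset.range n, edgeSign k ω) : ℝ) * Complex.I) ∂coinPairs)
      atTop (𝓝 (charFun gaussianProductLaw θ)) := by
  have hsqrt : Tendsto Nat.sqrt atTop atTop :=
    tendsto_atTop.2 fun b => (eventually_ge_atTop (b * b)).mono fun n hn => Nat.le_sqrt.2 hn
  have h1 := (tendsto_integral_exp_sum_edgeSign_mul_self θ).comp hsqrt
  refine tendsto_of_tendsto_of_dist h1 ?_
  have h0 : Tendsto (fun n : ℕ => |θ| * (√(2 * (√(n : ℝ))⁻¹) + (√(n : ℝ))⁻¹)) atTop (𝓝 0) := by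
    have := ((Real.continuous_sqrt.tendsto _).comp
      (tendsto_inv_sqrt_natCast.const_mul 2)).add tendsto_inv_sqrt_natCast
    simpa using this.const_mul |θ|
  refine squeeze_zero' (.of_forall fun n => dist_nonneg) ?_ h0
  filter_upwards [eventually_gt_atTop 0] with n hn
  rw [dist_comm, dist_eq_norm]
  refine (norm_integral_exp_sub_integral_exp_le ((integrable_sum_edgeSign _).const_mul _)
    ((integrable_sum_edgeSign _).const_mul _) θ).trans ?_
  gcongr
  exact integral_abs_sum_edgeSign_sub_le hn

/-! ### The limit law -/

/-- The characteristic function of `f(X) N` with `X` of law `μ` and `N` an independent standard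
normal variable. -/
lemma charFun_map_mul_gaussianReal (μ : Measure ℝ) [IsProbabilityMeasure μ] {f : ℝ → ℝ}
    (hf : Measurable f) (θ : ℝ) :
    charFun ((μ.prod (gaussianReal 0 1)).map fun p => f p.1 * p.2) θ
      = ((∫ x, Real.exp (-(θ ^ 2 * f x ^ 2 / 2)) ∂μ : ℝ) : ℂ) := by
  rw [charFun_apply_real, integral_map (by fun_prop) (by fun_prop), integral_prod,
    ← integral_complex_ofReal]
  · refine integral_congr_ae (.of_forall fun x => ?_)
    have h := charFun_gaussianReal (μ := 0) (v := 1) (θ * f x)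
    rw [charFun_apply_real] at h
    simp only
    push_cast at h ⊢
    simp only [← mul_assoc]
    rw [h]
    congr 1
    ring
  · refine Integrable.of_bound (by fun_prop) 1 (.of_forall fun p => ?_)
    have := Complex.norm_exp_ofReal_mul_I (θ * (f p.1 * p.2))
    push_cast at this ⊢
    exact this.le

lemma integral_exp_neg_sq_gaussianReal (θ : ℝ) :
    ∫ x, Real.exp (-(θ ^ 2 * x ^ 2 / 2)) ∂(gaussianReal 0 1) = (√(1 + θ ^ 2))⁻¹ := by
  rw [integral_gaussianReal_eq_integral_smul (by simp)]
  have h1 : (fun x => gaussianPDFReal 0 1 x • Real.exp (-(θ ^ 2 * x ^ 2 / 2)))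
      = fun x => (√(2 * Real.pi))⁻¹ * Real.exp (-((1 + θ ^ 2) / 2) * x ^ 2) := by
    ext x
    simp only [gaussianPDFReal, smul_eq_mul, mul_assoc, ← Real.exp_add]
    norm_num
    left
    ring
  rw [h1, integral_const_mul, integral_gaussian, ← Real.sqrt_inv, ← Real.sqrt_inv,
    ← Real.sqrt_mul (by positivity)]
  congr 1
  field_simp

lemma charFun_gaussianProductLaw (θ : ℝ) :
    charFun gaussianProductLaw θ = (((√(1 + θ ^ 2))⁻¹ : ℝ) : ℂ) := by
  rw [← integral_exp_neg_sq_gaussianReal]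
  exact charFun_map_mul_gaussianReal (gaussianReal 0 1) measurable_id θ

/-- The Laplace transform of the gamma distribution. -/
lemma integral_exp_neg_mul_gammaMeasure {a r s : ℝ} (ha : 0 < a) (hr : 0 < r) (hs : 0 ≤ s) :
    ∫ x, Real.exp (-(s * x)) ∂(gammaMeasure a r) = (r / (r + s)) ^ a := by
  have hm : Measurable (gammaPDF a r) := (measurable_gammaPDFReal a r).ennreal_ofReal
  rw [gammaMeasure, integral_withDensity_eq_integral_toReal_smul hm
    (.of_forall fun x => ENNReal.ofReal_lt_top)]
  have h1 : (fun x => (gammaPDF a r x).toReal • Real.exp (-(s * x)))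
      = (Set.Ici 0).indicator fun x =>
        r ^ a / Real.Gamma a * (x ^ (a - 1) * Real.exp (-((r + s) * x))) := by
    ext x
    by_cases hx : 0 ≤ x
    · rw [Set.indicator_of_mem (by simpa using hx), gammaPDF,
        ENNReal.toReal_ofReal (gammaPDFReal_nonneg ha hr x)]
      simp only [gammaPDFReal, hx, if_true, smul_eq_mul, mul_assoc, ← Real.exp_add]
      congr 3
      ring_nf
    · rw [Set.indicator_of_notMem (by simpa using hx)]
      simp [gammaPDF, gammaPDFReal, hx]
  rw [h1, integral_indicator measurableSet_Ici, integral_Ici_eq_integral_Ioi, integral_const_mul,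
    Real.integral_rpow_mul_exp_neg_mul_Ioi ha (by positivity), Real.div_rpow hr.le (by positivity),
    Real.div_rpow zero_le_one (by positivity), Real.one_rpow]
  have := (Real.Gamma_pos_of_pos ha).ne'
  field_simp

/-- A gamma variable of shape and rate `1 / 2` is the square of a standard normal, so this must
agree with `charFun_gaussianProductLaw`. The value comes from the Laplace transform at `θ ^ 2 / 2`.
-/
lemma charFun_varianceGamma_one (θ : ℝ) :
    charFun (varianceGamma 1 0 1 0) θ = (((√(1 + θ ^ 2))⁻¹ : ℝ) : ℂ) := by
  have : IsProbabilityMeasure (gammaMeasure (1 / 2) (1 / 2)) :=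
    isProbabilityMeasure_gammaMeasure (by norm_num) (by norm_num)
  have h := charFun_map_mul_gaussianReal (gammaMeasure (1 / 2) (1 / 2)) Real.continuous_sqrt.measurable θ
  simp only [varianceGamma, zero_add, zero_mul, one_mul]
  rw [h]
  congr 1
  -- Needed because `√x ^ 2 = x` fails for negative `x`.
  have hnn : ∀ᵐ x ∂(gammaMeasure (1 / 2) (1 / 2)), 0 ≤ x := by
    have hm : Measurable (gammaPDF (1 / 2) (1 / 2)) :=
      (measurable_gammaPDFReal _ _).ennreal_ofReal
    rw [gammaMeasure, ae_withDensity_iff hm]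
    refine .of_forall fun x hx => ?_
    by_contra! H
    exact hx (gammaPDF_of_neg H)
  have h2 : ∫ x, Real.exp (-(θ ^ 2 * √x ^ 2 / 2)) ∂(gammaMeasure (1 / 2) (1 / 2))
      = ∫ x, Real.exp (-((θ ^ 2 / 2) * x)) ∂(gammaMeasure (1 / 2) (1 / 2)) := by
    refine integral_congr_ae (hnn.mono fun x hx => ?_)
    simp only [Real.sq_sqrt hx]
    ring_nf
  rw [h2, integral_exp_neg_mul_gammaMeasure (by norm_num) (by norm_num) (by positivity),
    ← Real.sqrt_eq_rpow, ← Real.sqrt_inv]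
  congr 1
  field_simp

instance isProbabilityMeasure_varianceGamma_one : IsProbabilityMeasure (varianceGamma 1 0 1 0) := by
  have : IsProbabilityMeasure (gammaMeasure (1 / 2) (1 / 2)) :=
    isProbabilityMeasure_gammaMeasure (by norm_num) (by norm_num)
  unfold varianceGamma
  exact Measure.isProbabilityMeasure_map (by fun_prop)

instance isProbabilityMeasure_normalCombination (r : ℝ) (ν : Measure ℝ) [IsProbabilityMeasure ν] :
    IsProbabilityMeasure (normalCombination r ν) :=
  Measure.isProbabilityMeasure_map (by fun_prop)

lemma charFun_normalCombination {r : ℝ} (hr : r ^ 2 ≤ 1) (ν : Measure ℝ) [IsProbabilityMeasure ν]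
    (t : ℝ) :
    charFun (normalCombination r ν) t
      = ((Real.exp (-((1 - r ^ 2) * t ^ 2 / 2)) : ℝ) : ℂ) * charFun ν (r * t) := by
  rw [normalCombination, charFun_apply_real, integral_map (by fun_prop) (by fun_prop)]
  have h1 : (fun p : ℝ × ℝ => Complex.exp (t * ((√(1 - r ^ 2) * p.1 + r * p.2 : ℝ) : ℂ) * Complex.I))
      = fun p => Complex.exp (((√(1 - r ^ 2) * t : ℝ) : ℂ) * p.1 * Complex.I)
        * Complex.exp (((r * t : ℝ) : ℂ) * p.2 * Complex.I) := by
    ext p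
    rw [← Complex.exp_add]
    push_cast
    ring_nf
  rw [h1, integral_prod_mul (fun x : ℝ => Complex.exp (((√(1 - r ^ 2) * t : ℝ) : ℂ) * x * Complex.I))
    (fun x : ℝ => Complex.exp (((r * t : ℝ) : ℂ) * x * Complex.I)), ← charFun_apply_real,
    ← charFun_apply_real, charFun_gaussianReal]
  congr 1
  have : ((√(1 - r ^ 2) : ℝ) : ℂ) ^ 2 = 1 - (r : ℂ) ^ 2 := by
    rw [← Complex.ofReal_pow, Real.sq_sqrt (by linarith)]
    push_cast; ring
  push_cast
  rw [mul_pow, this]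
  congr 1
  ring_nf

/-- The law of `√(1 - r²) Z + r Y` with `Y` variance-gamma distributed is not normal. -/
lemma normalCombination_varianceGamma_ne_gaussianReal {r : ℝ} (hr : r ^ 2 ≤ 1) (hr0 : r ≠ 0)
    (m : ℝ) (v : NNReal) :
    normalCombination r (varianceGamma 1 0 1 0) ≠ gaussianReal m v := by
  intro h
  -- Taking norms of characteristic functions removes the mean `m`.
  have key (t : ℝ) : Real.exp (-((1 - r ^ 2) * t ^ 2 / 2)) * (√(1 + (r * t) ^ 2))⁻¹
      = Real.exp (-(v * t ^ 2 / 2)) := by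
    have h1 : ‖charFun (normalCombination r (varianceGamma 1 0 1 0)) t‖
        = ‖charFun (gaussianReal m v) t‖ := by rw [h]
    rw [charFun_normalCombination hr, charFun_varianceGamma_one, charFun_gaussianReal,
      ← Complex.ofReal_mul, Complex.norm_real, Real.norm_of_nonneg (by positivity),
      Complex.norm_exp] at h1
    rw [h1]
    congr 1
    have : (t * m * Complex.I - v * t ^ 2 / 2 : ℂ)
        = ((-(v * t ^ 2 / 2) : ℝ) : ℂ) + ((t * m : ℝ) : ℂ) * Complex.I := by
      push_cast; ring
    rw [this]
    simp [-Complex.ofReal_mul, -Complex.ofReal_neg]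
  have key2 (t : ℝ) : 1 + r ^ 2 * t ^ 2 = Real.exp ((v - (1 - r ^ 2)) * t ^ 2) := by
    have h1 : (Real.exp (-((1 - r ^ 2) * t ^ 2 / 2)) * (√(1 + (r * t) ^ 2))⁻¹) ^ 2
        = Real.exp (-(v * t ^ 2 / 2)) ^ 2 := by rw [key]
    rw [mul_pow, inv_pow, Real.sq_sqrt (by positivity), ← Real.exp_nat_mul, ← Real.exp_nat_mul] at h1
    have h2 : Real.exp ((v - (1 - r ^ 2)) * t ^ 2)
        = Real.exp (((2 : ℕ) : ℝ) * -((1 - r ^ 2) * t ^ 2 / 2))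
          / Real.exp (((2 : ℕ) : ℝ) * -(v * t ^ 2 / 2)) := by
      rw [← Real.exp_sub]
      push_cast
      ring_nf
    rw [h2, ← h1]
    field_simp
  -- The exponential at `t = √2` is the square of the one at `t = 1`, so `1 + 2 r² = (1 + r²)²`,
  -- which forces `r⁴ = 0`.
  have e1 := key2 1
  have e2 := key2 √2
  rw [Real.sq_sqrt (by norm_num), mul_comm _ (2 : ℝ), mul_comm _ (2 : ℝ)] at e2
  have e3 : Real.exp (2 * (v - (1 - r ^ 2))) = Real.exp ((v - (1 - r ^ 2)) * 1 ^ 2) ^ 2 := by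
    rw [← Real.exp_nat_mul]; push_cast; ring_nf
  rw [e3, ← e1] at e2
  have : r ^ 4 = 0 := by nlinarith
  exact hr0 (by simpa using this)

/-! ### The limit of the partial sums -/

/-- The telescoping estimate behind exchanging the factors of a characteristic function one at a
time. -/
lemma norm_prod_sub_prod_le {ι : Type*} (s : Finset ι) {f g : ι → ℂ} (hf : ∀ i, ‖f i‖ ≤ 1)
    (hg : ∀ i, ‖g i‖ ≤ 1) : ‖∏ i ∈ s, f i - ∏ i ∈ s, g i‖ ≤ ∑ i ∈ s, ‖f i - g i‖ := by
  classical
  induction s using Finset.induction_on with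
  | empty => simp
  | insert i s hi ih =>
    rw [Finset.prod_insert hi, Finset.prod_insert hi, Finset.sum_insert hi]
    have h : f i * ∏ j ∈ s, f j - g i * ∏ j ∈ s, g j
        = (f i - g i) * ∏ j ∈ s, f j + g i * (∏ j ∈ s, f j - ∏ j ∈ s, g j) := by ring
    have h1 : ‖∏ j ∈ s, f j‖ ≤ 1 := by
      rw [norm_prod]
      exact Finset.prod_le_one (fun _ _ => norm_nonneg _) fun j _ => hf j
    rw [h]
    refine (norm_add_le _ _).trans (add_le_add ?_ ?_)
    · rw [norm_mul]
      exact mul_le_of_le_one_right (norm_nonneg _) h1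
    · rw [norm_mul]
      exact (mul_le_of_le_one_left (norm_nonneg _) (hg i)).trans ih

/-- Characteristic functions of laws with the same first two moments agree to second order. -/
lemma isLittleO_charFun_sub_charFun {μ μ' : Measure ℝ} [IsProbabilityMeasure μ]
    [IsProbabilityMeasure μ'] (hμ : MemLp id 2 μ) (hμ' : MemLp id 2 μ')
    (h1 : ∫ x, x ∂μ = ∫ x, x ∂μ') (h2 : ∫ x, x ^ 2 ∂μ = ∫ x, x ^ 2 ∂μ') :
    (fun t => charFun μ t - charFun μ' t) =o[𝓝 0] fun t : ℝ => t ^ 2 := by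
  have key {μ : Measure ℝ} [IsProbabilityMeasure μ] (hμ : MemLp id 2 μ) :
      (fun t => charFun μ t - taylorWithinEval (charFun μ) 2 Set.univ 0 t)
        =o[𝓝 0] fun t : ℝ => t ^ 2 := by
    have := taylor_isLittleO_univ (x₀ := (0 : ℝ)) (n := 2) (f := charFun μ)
      (contDiff_charFun (n := 2) (by simpa using hμ))
    simpa using this
  have h3 : taylorWithinEval (charFun μ) 2 Set.univ 0
      = taylorWithinEval (charFun μ') 2 Set.univ 0 := by
    ext t
    have e (μ : Measure ℝ) [IsProbabilityMeasure μ] (hμ : MemLp id 2 μ) :=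
      taylorWithinEval_charFun_zero (μ := μ) (n := 2) (by simpa using hμ) t
    rw [e μ hμ, e μ' hμ']
    simp [Finset.sum_range_succ, h1, h2]
  have := (key hμ).sub (key hμ')
  rw [h3] at this
  simpa using this

lemma abs_exp_neg_sub_exp_neg_le {x y : ℝ} (hx : 0 ≤ x) (hy : 0 ≤ y) :
    |Real.exp (-x) - Real.exp (-y)| ≤ |x - y| := by
  wlog h : x ≤ y generalizing x y
  · rw [abs_sub_comm, abs_sub_comm x]
    exact this hy hx (le_of_not_ge h)
  have h1 : Real.exp (-y) ≤ Real.exp (-x) := Real.exp_le_exp.2 (by linarith)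
  rw [abs_of_nonneg (by linarith), abs_of_nonpos (by linarith)]
  have h2 : Real.exp (-y) = Real.exp (-x) * Real.exp (x - y) := by
    rw [← Real.exp_add]; ring_nf
  have h3 := Real.add_one_le_exp (x - y)
  have h4 : Real.exp (-x) ≤ 1 := Real.exp_le_one_iff.2 (by linarith)
  have h5 := Real.exp_pos (-x)
  rw [h2]
  nlinarith

section Limit

variable {ν : Bool → Measure ℝ} [∀ b, IsProbabilityMeasure (ν b)]

lemma measurable_prod_charFun_edgeLabel (ν : Bool → Measure ℝ) (n : ℕ) (u : ℝ) :
    Measurable fun ω => ∏ k ∈ Finset.range n, charFun (ν (edgeLabel k ω)) u :=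
  Finset.measurable_fun_prod _ fun k _ =>
    (measurable_of_finite fun b => charFun (ν b) u).comp (measurable_edgeLabel k)

lemma integrable_prod_charFun_edgeLabel (ν : Bool → Measure ℝ) [∀ b, IsProbabilityMeasure (ν b)]
    (n : ℕ) (u : ℝ) :
    Integrable (fun ω => ∏ k ∈ Finset.range n, charFun (ν (edgeLabel k ω)) u) coinPairs := by
  refine Integrable.of_bound (measurable_prod_charFun_edgeLabel ν n u).aestronglyMeasurable 1
    (.of_forall fun ω => ?_)
  rw [norm_prod]
  exact Finset.prod_le_one (fun _ _ => norm_nonneg _) fun j _ => norm_charFun_le_one _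

/-- Replacing the sample laws by normal laws with the same first two moments does not change the
limit. -/
lemma tendsto_integral_prod_charFun_sub {γ : Bool → Measure ℝ} [∀ b, IsProbabilityMeasure (γ b)]
    (h : ∀ b, (fun t => charFun (ν b) t - charFun (γ b) t) =o[𝓝 0] fun t : ℝ => t ^ 2) (t : ℝ) :
    Tendsto (fun n : ℕ =>
      ∫ ω, ∏ k ∈ Finset.range n, charFun (ν (edgeLabel k ω)) ((√(n : ℝ))⁻¹ * t) ∂coinPairs
      - ∫ ω, ∏ k ∈ Finset.range n, charFun (γ (edgeLabel k ω)) ((√(n : ℝ))⁻¹ * t) ∂coinPairs)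
      atTop (𝓝 0) := by
  have hu : Tendsto (fun n : ℕ => (√(n : ℝ))⁻¹ * t) atTop (𝓝 0) := by
    simpa using tendsto_inv_sqrt_natCast.mul_const t
  have hO : (fun n : ℕ => ((√(n : ℝ))⁻¹ * t) ^ 2) =O[atTop] fun n : ℕ => (n : ℝ)⁻¹ := by
    refine Asymptotics.IsBigO.of_bound (t ^ 2) (.of_forall fun n => le_of_eq ?_)
    rw [mul_pow, inv_pow, Real.sq_sqrt (by positivity), norm_mul, mul_comm,
      Real.norm_of_nonneg (sq_nonneg t)]
  -- Each of the `n` factors changes by `o(1 / n)`, uniformly in the labels since there are only two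
  -- laws.
  have hb (b : Bool) : Tendsto (fun n : ℕ => (n : ℝ) *
      ‖charFun (ν b) ((√(n : ℝ))⁻¹ * t) - charFun (γ b) ((√(n : ℝ))⁻¹ * t)‖) atTop (𝓝 0) := by
    have := (((h b).comp_tendsto hu).trans_isBigO hO).norm_left.tendsto_div_nhds_zero
    refine this.congr fun n => ?_
    simp [div_eq_mul_inv, mul_comm]
  refine squeeze_zero_norm (fun n => ?_) (by simpa using (hb true).add (hb false))
  set u := (√(n : ℝ))⁻¹ * t
  rw [← integral_sub (integrable_prod_charFun_edgeLabel ν n u)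
    (integrable_prod_charFun_edgeLabel γ n u)]
  refine (norm_integral_le_of_norm_le_const (.of_forall fun ω =>
    (norm_prod_sub_prod_le _ (fun _ => norm_charFun_le_one _)
      (fun _ => norm_charFun_le_one _)).trans (Finset.sum_le_card_nsmul _ _
        (‖charFun (ν true) u - charFun (γ true) u‖ + ‖charFun (ν false) u - charFun (γ false) u‖)
        fun k _ => ?_))).trans (le_of_eq ?_)
  · cases edgeLabel k ω
    · exact le_add_of_nonneg_left (norm_nonneg _)
    · exact le_add_of_nonneg_right (norm_nonneg _)
  · simp

/-- The normal case. -/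
lemma tendsto_integral_prod_charFun_gaussianReal (a : ℝ) (v : Bool → NNReal) (t : ℝ) :
    Tendsto (fun n : ℕ => ∫ ω, ∏ k ∈ Finset.range n,
        charFun (gaussianReal (boolSign (edgeLabel k ω) * a) (v (edgeLabel k ω)))
          ((√(n : ℝ))⁻¹ * t) ∂coinPairs) atTop
      (𝓝 (((Real.exp (-(((v true + v false) / 2 : ℝ) * t ^ 2 / 2)) : ℝ) : ℂ)
        * charFun gaussianProductLaw (a * t))) := by
  -- The variances are split into mean and half-difference. With `S` the sum of edge signs, `w`
  -- enters the exponent only through `w * S / n`, which is of order `1 / √n` in `L¹`; hence only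
  -- `V` survives.
  set V : ℝ := (v true + v false) / 2 with hV
  set w : ℝ := (v true - v false) / 2 with hw
  have hv (b : Bool) : (v b : ℝ) = V + boolSign b * w := by
    cases b <;> simp [hV, hw] <;> ring
  have hV0 : 0 ≤ V := by positivity
  refine ((tendsto_integral_exp_sum_edgeSign (a * t)).const_mul _).congr_dist ?_
  have h0 : Tendsto (fun n : ℕ => t ^ 2 * |w| / 2 * (√(n : ℝ))⁻¹) atTop (𝓝 0) := by
    simpa using tendsto_inv_sqrt_natCast.const_mul (t ^ 2 * |w| / 2)
  refine squeeze_zero' (.of_forall fun n => dist_nonneg) ?_ h0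
  filter_upwards [eventually_gt_atTop 0] with n hn
  have hn0 : (0 : ℝ) < n := by exact_mod_cast hn
  have hs0 : 0 < √(n : ℝ) := Real.sqrt_pos.2 hn0
  have hsq : (√(n : ℝ))⁻¹ ^ 2 = (n : ℝ)⁻¹ := by rw [inv_pow, Real.sq_sqrt hn0.le]
  set u := (√(n : ℝ))⁻¹ * t with hu
  have hu2 : u ^ 2 = (n : ℝ)⁻¹ * t ^ 2 := by rw [hu, mul_pow, hsq]
  have hprod (ω) : ∏ k ∈ Finset.range n,
        charFun (gaussianReal (boolSign (edgeLabel k ω) * a) (v (edgeLabel k ω))) u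
      = ((Real.exp (-(V * t ^ 2 / 2 + t ^ 2 * w / 2 * (n : ℝ)⁻¹ *
          ∑ k ∈ Finset.range n, edgeSign k ω)) : ℝ) : ℂ)
        * Complex.exp ((a * t * ((√(n : ℝ))⁻¹ * ∑ k ∈ Finset.range n, edgeSign k ω) : ℝ)
          * Complex.I) := by
    simp only [charFun_gaussianReal]
    rw [← Complex.exp_sum, Complex.ofReal_exp, ← Complex.exp_add]
    congr 1
    have e (k : ℕ) : (u : ℂ) * ((boolSign (edgeLabel k ω) * a : ℝ) : ℂ) * Complex.I
        - ((v (edgeLabel k ω) : ℝ) : ℂ) * (u : ℂ) ^ 2 / 2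
        = -((V : ℂ) * (u : ℂ) ^ 2 / 2) + (edgeSign k ω : ℂ) *
          ((u : ℂ) * a * Complex.I - w * (u : ℂ) ^ 2 / 2) := by
      rw [hv, edgeSign]
      push_cast
      ring
    have hu2' : (u : ℂ) ^ 2 = (n : ℂ)⁻¹ * (t : ℂ) ^ 2 := by
      rw [← Complex.ofReal_pow, hu2]
      push_cast
      rfl
    have hn0' : (n : ℂ) ≠ 0 := by exact_mod_cast hn0.ne'
    rw [Finset.sum_congr rfl fun k _ => e k, Finset.sum_add_distrib, ← Finset.sum_mul, hu2',
      Finset.sum_const, Finset.card_range, nsmul_eq_mul, hu]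
    push_cast
    field_simp
    ring
  -- Recombined, the exponent is a nonnegative multiple of a sum of variances; the Lipschitz bound
  -- for `exp (-x)` requires this sign.
  have hpos (ω) : 0 ≤ V * t ^ 2 / 2 + t ^ 2 * w / 2 * (n : ℝ)⁻¹ *
      ∑ k ∈ Finset.range n, edgeSign k ω := by
    have : V * t ^ 2 / 2 + t ^ 2 * w / 2 * (n : ℝ)⁻¹ * ∑ k ∈ Finset.range n, edgeSign k ω
        = t ^ 2 / 2 * (n : ℝ)⁻¹ * ∑ k ∈ Finset.range n, (v (edgeLabel k ω) : ℝ) := by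
      have e (k : ℕ) : boolSign (edgeLabel k ω) = edgeSign k ω := rfl
      simp only [hv, e, Finset.sum_add_distrib, ← Finset.sum_mul, Finset.sum_const,
        Finset.card_range, nsmul_eq_mul]
      field_simp
    rw [this]
    positivity
  have hexp : Integrable (fun ω => Complex.exp ((a * t * ((√(n : ℝ))⁻¹ *
      ∑ k ∈ Finset.range n, edgeSign k ω) : ℝ) * Complex.I)) coinPairs := by
    have := measurable_edgeSign
    refine Integrable.of_bound (Measurable.aestronglyMeasurable (by fun_prop)) 1 (.of_forall fun ω => ?_)
    rw [Complex.norm_exp_ofReal_mul_I]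
  rw [dist_comm, dist_eq_norm, ← integral_const_mul, ← integral_sub
    (integrable_prod_charFun_edgeLabel (fun b => gaussianReal (boolSign b * a) (v b)) n u)
    (hexp.const_mul _)]
  have hbound : ∫ ω, t ^ 2 * |w| / 2 * (n : ℝ)⁻¹ * |∑ k ∈ Finset.range n, edgeSign k ω| ∂coinPairs
      ≤ t ^ 2 * |w| / 2 * (√(n : ℝ))⁻¹ := by
    rw [integral_const_mul]
    have := integral_abs_sum_edgeSign_le (Finset.range n)
    rw [Finset.card_range] at this
    calc _ ≤ t ^ 2 * |w| / 2 * (n : ℝ)⁻¹ * √(n : ℝ) := by gcongr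
      _ = _ := by
        rw [← hsq]
        field_simp
  refine (norm_integral_le_of_norm_le
    ((integrable_sum_edgeSign (Finset.range n)).abs.const_mul (t ^ 2 * |w| / 2 * (n : ℝ)⁻¹))
    (.of_forall fun ω => ?_)).trans hbound
  rw [hprod, ← sub_mul, norm_mul, Complex.norm_exp_ofReal_mul_I, mul_one, ← Complex.ofReal_sub,
    Complex.norm_real]
  refine (abs_exp_neg_sub_exp_neg_le (hpos ω) (by positivity)).trans (le_of_eq ?_)
  rw [add_sub_cancel_left, abs_mul, abs_mul, abs_div, abs_mul, abs_of_pos (inv_pos.2 hn0),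
    abs_of_nonneg (sq_nonneg t), abs_of_pos (zero_lt_two (α := ℝ))]

/-- The limit of the characteristic functions of the partial sums. -/
lemma tendsto_integral_prod_charFun_edgeLabel {a : ℝ} (hL2 : ∀ b, MemLp id 2 (ν b))
    (hmean : ∀ b, ∫ x, x ∂(ν b) = boolSign b * a)
    (hvar : (∫ x, x ^ 2 ∂(ν true) + ∫ x, x ^ 2 ∂(ν false)) / 2 = 1) (t : ℝ) :
    Tendsto (fun n : ℕ => ∫ ω, ∏ k ∈ Finset.range n,
        charFun (ν (edgeLabel k ω)) ((√(n : ℝ))⁻¹ * t) ∂coinPairs) atTop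
      (𝓝 (((Real.exp (-((1 - a ^ 2) * t ^ 2 / 2)) : ℝ) : ℂ)
        * charFun gaussianProductLaw (a * t))) := by
  -- With this variance the normal law of mean `boolSign b * a` shares its first two moments with `ν
  -- b`.
  set v : Bool → NNReal := fun b => (variance id (ν b)).toNNReal with hv
  have hvb (b : Bool) : (v b : ℝ) = ∫ x, x ^ 2 ∂(ν b) - a ^ 2 := by
    rw [hv, Real.coe_toNNReal _ (variance_nonneg _ _), variance_eq_sub (hL2 b)]
    simp [hmean, mul_pow, sq (boolSign b), boolSign_mul_self]
  have hO (b : Bool) : (fun t => charFun (ν b) t - charFun (gaussianReal (boolSign b * a) (v b)) t)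
      =o[𝓝 0] fun t : ℝ => t ^ 2 := by
    have hg : MemLp id 2 (gaussianReal (boolSign b * a) (v b)) := memLp_id_gaussianReal 2
    refine isLittleO_charFun_sub_charFun (hL2 b) hg ?_ ?_
    · rw [hmean, integral_id_gaussianReal]
    · have h1 := variance_eq_sub hg
      rw [variance_id_gaussianReal, hvb] at h1
      simp [mul_pow, sq (boolSign b), boolSign_mul_self] at h1
      linarith
  have h1 := tendsto_integral_prod_charFun_sub hO t
  have h2 := tendsto_integral_prod_charFun_gaussianReal a v t
  have hV : ((v true + v false) / 2 : ℝ) = 1 - a ^ 2 := by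
    rw [hvb, hvb]
    linarith
  rw [hV] at h2
  simpa using h1.add h2

end Limit

/-! ### Splitting a law into two halves with different means -/

/-- The measure with density `1 ± (1_{x > 0} - η(x > 0))` with respect to `η`. -/
noncomputable def halfLaw (η : Measure ℝ) (b : Bool) : Measure ℝ :=
  η.withDensity fun x =>
    ENNReal.ofReal (1 + boolSign b * ((Set.Ioi (0 : ℝ)).indicator 1 x - η.real (Set.Ioi 0)))

section HalfLaw

variable {η : Measure ℝ} [IsProbabilityMeasure η]

lemma abs_indicator_sub_measureReal_le (η : Measure ℝ) [IsProbabilityMeasure η] (x : ℝ) :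
    |(Set.Ioi (0 : ℝ)).indicator 1 x - η.real (Set.Ioi 0)| ≤ 1 := by
  have h0 : 0 ≤ η.real (Set.Ioi 0) := measureReal_nonneg
  have h1 : η.real (Set.Ioi 0) ≤ 1 := measureReal_le_one
  by_cases hx : x ∈ Set.Ioi (0 : ℝ)
  · rw [Set.indicator_of_mem hx, Pi.one_apply, abs_le]
    constructor <;> linarith
  · rw [Set.indicator_of_notMem hx, abs_le]
    constructor <;> linarith

lemma halfLaw_density_mem_Icc (η : Measure ℝ) [IsProbabilityMeasure η] (b : Bool) (x : ℝ) :
    1 + boolSign b * ((Set.Ioi (0 : ℝ)).indicator 1 x - η.real (Set.Ioi 0)) ∈ Set.Icc (0 : ℝ) 2 := by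
  have h := abs_le.1 (abs_indicator_sub_measureReal_le η x)
  cases b <;> simp only [boolSign_true, boolSign_false, Set.mem_Icc] <;> constructor <;> linarith

lemma measurable_indicator_sub_measureReal (η : Measure ℝ) :
    Measurable fun x : ℝ => (Set.Ioi (0 : ℝ)).indicator (1 : ℝ → ℝ) x - η.real (Set.Ioi 0) :=
  (measurable_one.indicator measurableSet_Ioi).sub_const _

lemma halfLaw_le (b : Bool) : halfLaw η b ≤ (2 : ℝ≥0∞) • η := by
  rw [halfLaw, ← withDensity_const]
  refine withDensity_mono (.of_forall fun x => ?_)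
  have := ENNReal.ofReal_le_ofReal (halfLaw_density_mem_Icc η b x).2
  simpa using this

/-- The correction term is odd in the sign, so it cancels when the two halves are averaged; the
mixture identity and the second moment both rest on this. -/
lemma integral_halfLaw {E : Type*} [NormedAddCommGroup E] [NormedSpace ℝ E] {f : ℝ → E}
    (hf : Integrable f η) (b : Bool) :
    ∫ x, f x ∂(halfLaw η b) = ∫ x, f x ∂η + boolSign b •
      ∫ x, ((Set.Ioi (0 : ℝ)).indicator 1 x - η.real (Set.Ioi 0)) • f x ∂η := by
  have hm := measurable_indicator_sub_measureReal η
  have hi : Integrable (fun x =>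
      ((Set.Ioi (0 : ℝ)).indicator 1 x - η.real (Set.Ioi 0)) • f x) η :=
    hf.bdd_smul 1 hm.aestronglyMeasurable
      (.of_forall fun x => abs_indicator_sub_measureReal_le η x)
  rw [halfLaw, integral_withDensity_eq_integral_toReal_smul (by fun_prop)
    (.of_forall fun x => ENNReal.ofReal_lt_top), ← integral_smul, ← integral_add hf (hi.fun_smul _)]
  refine integral_congr_ae (.of_forall fun x => ?_)
  simp only
  rw [ENNReal.toReal_ofReal (halfLaw_density_mem_Icc η b x).1, add_smul, one_smul, mul_smul]

lemma integral_indicator_sub_measureReal :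
    ∫ x, ((Set.Ioi (0 : ℝ)).indicator 1 x - η.real (Set.Ioi 0)) ∂η = 0 := by
  rw [integral_sub ((integrable_const 1).indicator measurableSet_Ioi) (integrable_const _),
    integral_indicator_one measurableSet_Ioi]
  simp

instance isProbabilityMeasure_halfLaw (b : Bool) : IsProbabilityMeasure (halfLaw η b) := by
  have h := integral_halfLaw (η := η) (integrable_const (1 : ℝ)) b
  simp only [smul_eq_mul, mul_one, integral_indicator_sub_measureReal, integral_const,
    probReal_univ, mul_zero, add_zero] at h
  exact ⟨(ENNReal.toReal_eq_one_iff _).1 h⟩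

lemma memLp_halfLaw (h : MemLp id 2 η) (b : Bool) : MemLp id 2 (halfLaw η b) :=
  h.of_measure_le_smul (by simp) (halfLaw_le b)

lemma charFun_eq_halfLaw (t : ℝ) :
    charFun η t = (charFun (halfLaw η true) t + charFun (halfLaw η false) t) / 2 := by
  have hi : Integrable (fun x : ℝ => Complex.exp (t * x * Complex.I)) η := by
    refine Integrable.of_bound (by fun_prop) 1 (.of_forall fun x => ?_)
    have := Complex.norm_exp_ofReal_mul_I (t * x)
    push_cast at this
    exact this.le
  simp only [charFun_apply_real]
  rw [integral_halfLaw hi, integral_halfLaw hi, boolSign_true, boolSign_false, one_smul, neg_smul, one_smul]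
  ring

lemma integral_sq_halfLaw (h : MemLp id 2 η) :
    (∫ x, x ^ 2 ∂(halfLaw η true) + ∫ x, x ^ 2 ∂(halfLaw η false)) / 2 = ∫ x, x ^ 2 ∂η := by
  have hi : Integrable (fun x : ℝ => x ^ 2) η := h.integrable_sq
  rw [integral_halfLaw hi, integral_halfLaw hi, boolSign_true, boolSign_false, one_smul, neg_smul, one_smul]
  ring

/-- As `η` is centered, the constant `η.real (Set.Ioi 0)` in the density contributes nothing to the
mean. -/
lemma integral_id_halfLaw (h : MemLp id 2 η) (h0 : ∫ x, x ∂η = 0) (b : Bool) :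
    ∫ x, x ∂(halfLaw η b) = boolSign b * ∫ x in Set.Ioi 0, x ∂η := by
  have hi : Integrable (fun x : ℝ => x) η := h.integrable (by simp)
  rw [integral_halfLaw hi, h0, zero_add, smul_eq_mul, ← integral_indicator measurableSet_Ioi]
  congr 1
  have : (fun x : ℝ => ((Set.Ioi (0 : ℝ)).indicator 1 x - η.real (Set.Ioi 0)) • x)
      = fun x => (Set.Ioi (0 : ℝ)).indicator (fun x => x) x - η.real (Set.Ioi 0) * x := by
    ext x
    by_cases hx : x ∈ Set.Ioi (0 : ℝ) <;> simp [hx, sub_mul]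
  rw [this, integral_sub (hi.indicator measurableSet_Ioi) (hi.const_mul _), integral_const_mul, h0]
  simp

/-- A centered law that is not degenerate charges the positive numbers. -/
lemma setIntegral_Ioi_id_pos (h : MemLp id 2 η) (h0 : ∫ x, x ∂η = 0) (h1 : ∫ x, x ^ 2 ∂η = 1) :
    0 < ∫ x in Set.Ioi 0, x ∂η := by
  have hi : Integrable (fun x : ℝ => x) η := h.integrable (by simp)
  have hnn : 0 ≤ ∫ x in Set.Ioi 0, x ∂η :=
    setIntegral_nonneg measurableSet_Ioi fun x hx => le_of_lt hx
  refine hnn.lt_of_ne fun H => ?_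
  have hp : (Set.Ioi (0 : ℝ)).indicator (fun x => x) =ᵐ[η] 0 := by
    rw [← integral_indicator measurableSet_Ioi] at H
    exact (integral_eq_zero_iff_of_nonneg
      (fun x => Set.indicator_nonneg (fun x hx => le_of_lt hx) x)
      (hi.indicator measurableSet_Ioi)).1 H.symm
  have hneg : ∀ᵐ x ∂η, x ≤ 0 := by
    filter_upwards [hp] with x hx
    by_contra! hc
    rw [Set.indicator_of_mem (Set.mem_Ioi.2 hc)] at hx
    exact hc.ne' hx
  -- A variable that is almost surely nonpositive with mean zero vanishes almost surely, against the
  -- second moment 1.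
  have hz : (fun x : ℝ => -x) =ᵐ[η] 0 := by
    refine (integral_eq_zero_iff_of_nonneg_ae (hneg.mono fun x hx => ?_) hi.neg).1 ?_
    · simpa using hx
    · exact (integral_neg _).trans (by rw [h0, neg_zero])
  have : ∫ x, x ^ 2 ∂η = 0 := by
    rw [integral_eq_zero_of_ae]
    filter_upwards [hz] with x hx
    have : x = 0 := by simpa using hx
    simp [this]
  linarith

/-- Each half has nonnegative variance, so its squared mean is at most its second moment; these
second moments average to 1. -/
lemma setIntegral_Ioi_id_sq_le_one (h : MemLp id 2 η) (h0 : ∫ x, x ∂η = 0)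
    (h1 : ∫ x, x ^ 2 ∂η = 1) : (∫ x in Set.Ioi 0, x ∂η) ^ 2 ≤ 1 := by
  have hb (b : Bool) : (∫ x in Set.Ioi 0, x ∂η) ^ 2 ≤ ∫ x, x ^ 2 ∂(halfLaw η b) := by
    have h2 := variance_eq_sub (memLp_halfLaw h b)
    have h3 := variance_nonneg id (halfLaw η b)
    rw [h2] at h3
    simp only [Pi.pow_apply, id, integral_id_halfLaw h h0, mul_pow, sq (boolSign b),
      boolSign_mul_self, one_mul] at h3
    linarith
  have := integral_sq_halfLaw h
  linarith [hb true, hb false]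

end HalfLaw

/-! ### The counterexample -/

/-- The standardized case. -/
lemma tendstoInDistribution_sum_edgeSample {η : Measure ℝ} [IsProbabilityMeasure η]
    (h : MemLp id 2 η) (h0 : ∫ x, x ∂η = 0) (h1 : ∫ x, x ^ 2 ∂η = 1) :
    TendstoInDistribution (fun (n : ℕ) x => (√(n : ℝ))⁻¹ * ∑ k ∈ Finset.range n, edgeSample k x)
      atTop id (fun _ => edgeSampleLaw (halfLaw η))
      (normalCombination (∫ x in Set.Ioi 0, x ∂η) (varianceGamma 1 0 1 0)) := by
  have hm := measurable_edgeSample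
  refine ⟨fun n => by fun_prop, by fun_prop, ?_⟩
  refine ProbabilityMeasure.tendsto_iff_tendsto_charFun.2 fun t => ?_
  simp only [ProbabilityMeasure.coe_mk, Measure.map_id, charFun_map_mul_sum_edgeSample]
  rw [charFun_normalCombination (setIntegral_Ioi_id_sq_le_one h h0 h1), charFun_varianceGamma_one,
    ← charFun_gaussianProductLaw]
  exact tendsto_integral_prod_charFun_edgeLabel (memLp_halfLaw h) (integral_id_halfLaw h h0)
    ((integral_sq_halfLaw h).trans h1) t

theorem theorem1 {Ω : Type*} [MeasurableSpace Ω] (P : Measure Ω) [IsProbabilityMeasure P]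
    (W : Ω → ℝ) (hW : MemLp W 2 P) (hconst : ¬ ∃ c : ℝ, ∀ᵐ ω ∂P, W ω = c) :
    ∃ (Ω' : Type) (_ : MeasurableSpace Ω') (P' : Measure Ω') (_ : IsProbabilityMeasure P')
      (X : ℕ → Ω' → ℝ),
      (∀ k, Measurable (X k)) ∧
      (∀ k, IdentDistrib (X k) W P' P) ∧
      TuplewiseIndep 3 X P' ∧
      ∃ L : ProbabilityMeasure ℝ,
        TendstoInDistribution (standardizedSum (∫ ω, W ω ∂P) (√(variance W P)) X) atTop id
          (fun _ => P') (L : Measure ℝ) ∧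
        (∀ (m : ℝ) (v : NNReal), (L : Measure ℝ) ≠ gaussianReal m v) ∧
        ∃ (ℓ : ℕ) (r : ℝ), 2 ≤ ℓ ∧ 0 < r ∧ r ≤ 1 ∧
          (L : Measure ℝ) =
            normalCombination r (varianceGamma ((ℓ : ℝ) - 1) 0 (1 / √((ℓ : ℝ) - 1)) 0) := by
  have hvar : 0 < variance W P := by
    refine (variance_nonneg W P).lt_of_ne fun H => hconst ⟨∫ ω, W ω ∂P, ?_⟩
    exact ae_eq_integral_of_variance_eq_zero hW H.symm
  set μ := ∫ ω, W ω ∂P with hμ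
  set σ := √(variance W P) with hσ
  have hσ0 : 0 < σ := Real.sqrt_pos.2 hvar
  have hσ2 : σ ^ 2 = variance W P := Real.sq_sqrt hvar.le
  have hWm : AEMeasurable W P := hW.1.aemeasurable
  have hWi : Integrable W P := hW.integrable (by simp)
  have hZm : AEMeasurable (fun ω => (W ω - μ) / σ) P := by fun_prop
  set η : Measure ℝ := P.map fun ω => (W ω - μ) / σ with hη
  have : IsProbabilityMeasure η := Measure.isProbabilityMeasure_map hZm
  have hL2 : MemLp id 2 η := by
    rw [hη, memLp_map_measure_iff (by fun_prop) hZm]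
    have := (hW.sub (memLp_const μ)).const_mul σ⁻¹
    refine this.congr_norm (by fun_prop) (.of_forall fun ω => ?_)
    simp [div_eq_inv_mul]
  have h0 : ∫ x, x ∂η = 0 := by
    rw [hη, integral_map hZm (by fun_prop), integral_div, integral_sub hWi (integrable_const _)]
    simp [hμ]
  have h1 : ∫ x, x ^ 2 ∂η = 1 := by
    rw [hη, integral_map hZm (by fun_prop)]
    simp only [div_pow]
    rw [integral_div, ← variance_eq_integral hWm, hσ2, div_self hvar.ne']
  set r := ∫ x in Set.Ioi 0, x ∂η with hr
  have hr0 : 0 < r := setIntegral_Ioi_id_pos hL2 h0 h1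
  have hr1 : r ^ 2 ≤ 1 := setIntegral_Ioi_id_sq_le_one hL2 h0 h1
  have hm := measurable_edgeSample
  -- The witness for `ℓ` is 2, for which `ℓ - 1 = 1` and the required law is `varianceGamma 1 0 1
  -- 0`. The samples, standardized so far, are rescaled by `σ` and shifted by `μ`.
  refine ⟨_, inferInstance, edgeSampleLaw (halfLaw η), inferInstance,
    fun k x => σ * edgeSample k x + μ, fun k => by fun_prop, fun k => ?_, fun e he => ?_,
    ⟨normalCombination r (varianceGamma 1 0 1 0), inferInstance⟩, ?_, ?_, 2, r, le_rfl, hr0,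
    by nlinarith, ?_⟩
  · have hid : IdentDistrib (edgeSample k) (fun ω => (W ω - μ) / σ) (edgeSampleLaw (halfLaw η)) P :=
      ⟨by fun_prop, hZm, map_edgeSample (halfLaw η) charFun_eq_halfLaw k⟩
    have := hid.comp (u := fun x => σ * x + μ) (by fun_prop)
    have hWeq : (fun x => σ * x + μ) ∘ (fun ω => (W ω - μ) / σ) = W := by
      ext ω
      simp only [Function.comp_apply]
      field_simp
      ring
    rwa [hWeq] at this
  · exact (tuplewiseIndep_edgeSample (halfLaw η) e he).comp (fun _ x => σ * x + μ)
      fun _ => by fun_prop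
  · have hlim := tendstoInDistribution_sum_edgeSample hL2 h0 h1
    have hsum : standardizedSum μ σ (fun k x => σ * edgeSample k x + μ)
        = fun (n : ℕ) x => (√(n : ℝ))⁻¹ * ∑ k ∈ Finset.range n, edgeSample k x := by
      ext n x
      rw [standardizedSum, Finset.sum_add_distrib, ← Finset.mul_sum]
      simp only [Finset.sum_const, Finset.card_range, nsmul_eq_mul, add_sub_cancel_right]
      field_simp
    rw [hsum]
    exact hlim
  · exact fun m v => normalCombination_varianceGamma_ne_gaussianReal hr1 hr0.ne' m v
  · norm_num
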